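/- Let $m\ge 2$ have prime factorization $m=\prod_{i=1}^{h}p_i^{k_i}$, let $l,r\in\mathbb Z$ and let $a_l,\dots,a_r$ be integers. Let $f(x_l,\dots,x_r)=\sum_{j=l}^{r}a_jx_j \pmod m$, let $T$ be the cellular automaton $(Tx)_n=f(x_{n+l},\dots,x_{n+r})$ on $\mathbb Z_m^{\mathbb Z}$, let $\sigma$ be the shift, $(\sigma x)_n=x_{n+1}$, and let $\Phi^{(n,t)}=T^{t}\circ\sigma^{n}$ for $n\in\mathbb Z$, $t\in\mathbb Z_{\ge 0}$. For each $i$ let $f_{p_i}$ be the reduction of $f$ modulo $p_i^{k_i}$ and let $\Phi_{p_i}$ be the corresponding action on $\mathbb Z_{p_i^{k_i}}^{\mathbb Z}$, generated by the cellular automaton with local rule $f_{p_i}$ and the shift. Assume that for every $i$ the rule $f_{p_i}$ is left and right permutative, in the sense that it is permutative in some variable $x_j$ with $j\le 0$ and in some variable $x_{j'}$ with $j'\ge 0$. (A rule is permutative in $x_j$ if it is a bijection as a function of $x_j$ for any fixed values of the other variables.) For $\theta\in[0,\pi]$ define the topological directional entropy of $\Phi$ by $$h_\theta(\Phi)=\lim_{\varepsilon\to0^+}\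 \limsup_{w\to\infty}\ \limsup_{T\to\infty}\ \frac1T\log N(\varepsilon,W(w,T,\theta)),$$ where $W(w,T,\theta)=\{(x+y\cos\theta,\;y\sin\theta): -w<x<w,\ 0<y\le T\}$ and $N(\varepsilon,W)$ is the largest cardinality of a set $M$ of configurations such that for any two distinct $x,\bar x\in M$ there is an integer point $(n,t)\in W$ with $d(\Phi^{(n,t)}x,\Phi^{(n,t)}\bar x)\ge\varepsilon$. Here $d(x,y)=\sum_{i\in\mathbb Z}|x_i-y_i|\,m^{-|i|}$, with states read as $0,\dots,m-1$. Define $h_\theta(\Phi_{p_i})$ in the same way, with $p_i^{k_i}$ in place of $m$. Put $P_i=\{0\}\cup\{j\in[l,r]:\gcd(a_j,p_i)=1\}$, $L_i=\min P_i$, $R_i=\max P_i$, $\theta_{L_i}=\operatorname{arccot}(-L_i)$ and $\theta_{R_i}=\operatorname{arccot}(-R_i)$, where $\operatorname{arccot}$ takes values in $(0,\pi)$; thus $\theta_{L_i}\le\theta_{R_i}$. Then for every $\theta\in[0,\pi]$ $$h_\theta(\Phi)=\sum_{i=1}^{h}h_\theta(\Phi_{p_i})=\sum_{i=1}^{h}g_i(\theta),$$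 where $$g_i(\theta)=\begin{cases}k_i\,|\cos\theta+R_i\sin\theta|\,\log p_i,&\theta\in[0,\theta_{L_i}],\\ k_i\,|(R_i-L_i)\sin\theta|\,\log p_i,&\theta\in[\theta_{L_i},\theta_{R_i}],\\ k_i\,|\cos\theta+L_i\sin\theta|\,\log p_i,&\theta\in[\theta_{R_i},\pi],\end{cases}$$ and the pieces agree at common endpoints. Equivalently, whenever $\{1,\dots,h\}$ is a disjoint union $A\cup B\cup C$ such that $\theta\le\theta_{L_i}$ for $i\in A$, $\theta_{L_i}\le\theta\le\theta_{R_i}$ for $i\in B$, and $\theta_{R_i}\le\theta$ for $i\in C$, $$h_\theta(\Phi)=\sum_{i\in A}k_i|\cos\theta+R_i\sin\theta|\log p_i+\sum_{i\in B}k_i|(R_i-L_i)\sin\theta|\log p_i+\sum_{i\in C}k_i|\cos\theta+L_i\sin\theta|\log p_i .$$ In particular, $h_\theta(\Phi)=\sum_i k_i|\cos\theta+R_i\sin\theta|\log p_i$ on $[0,\min_j\theta_{L_j}]$ and $h_\theta(\Phi)=\sum_i k_i|\cos\theta+L_i\sin\theta|\log p_i$ on $[\max_j\theta_{R_j},\pi]$.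 -/

import Mathlib

open Filter Topology

noncomputable section

namespace LCA

/-! ### Linear cellular automata over `ZMod m` and the action they generate with the shift -/

/-- A local rule `f : A ^ ι → A` is permutative in the variable `j` if, whatever the values of the
other variables are, `f` is a bijection of `A` as a function of the `j`-th variable. -/
def PermutativeIn {ι A : Type*} [DecidableEq ι] (f : (ι → A) → A) (j : ι) : Prop :=
  ∀ x : ι → A, Function.Bijective fun c : A => f (Function.update x j c)

/-- The linear local rule `f (x_l, …, x_r) = ∑_{i = l}^r a_i x_i (mod m)`. Its reduction modulo a
divisor `d` of `m` is `localRule d l r a`. -/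
def localRule (m : ℕ) (l r : ℤ) (a : ℤ → ℤ) (x : Finset.Icc l r → ZMod m) : ZMod m :=
  ∑ i : Finset.Icc l r, (a i : ZMod m) * x i

/-- The one-dimensional cellular automaton `(T x)_n = f (x_{n+l}, …, x_{n+r})`. -/
def automaton (m : ℕ) (l r : ℤ) (a : ℤ → ℤ) (x : ℤ → ZMod m) : ℤ → ZMod m :=
  fun n => localRule m l r a fun i => x (n + i)

/-- The power `σ ^ u` of the shift: `(σ ^ u x)_n = x_{n+u}`. -/
def shift {A : Type*} (u : ℤ) (x : ℤ → A) : ℤ → A := fun n => x (n + u)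

/-- The action `Φ^{(u,s)} = T ^ s ∘ σ ^ u` generated by the automaton and the shift. -/
def action (m : ℕ) (l r : ℤ) (a : ℤ → ℤ) (q : ℤ × ℕ) (x : ℤ → ZMod m) : ℤ → ZMod m :=
  (automaton m l r a)^[q.2] (shift q.1 x)

/-- The metric `d(x, y) = ∑_i |x_i - y_i| / m^|i|` on configurations, the states being read as
`0, …, m - 1`. -/
def configDist (m : ℕ) (x y : ℤ → ZMod m) : ℝ :=
  ∑' i : ℤ, |((x i).val : ℝ) - ((y i).val : ℝ)| / (m : ℝ) ^ i.natAbs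

/-! ### Topological directional entropy -/

/-- The lattice points, with nonnegative time coordinate, of the parallelogram
`{(x + y cos θ, y sin θ) : -w < x < w, 0 < y ≤ T}`. -/
def window (w T θ : ℝ) : Set (ℤ × ℕ) :=
  {q | ∃ x y : ℝ, -w < x ∧ x < w ∧ 0 < y ∧ y ≤ T ∧
    (q.1 : ℝ) = x + y * Real.cos θ ∧ (q.2 : ℝ) = y * Real.sin θ}

/-- Any two distinct points of `M` are moved at distance at least `ε` by some `Φ^{(n,t)}` with
`(n, t)` in `W`. -/
def IsSeparated {X : Type*} (d : X → X → ℝ) (Φ : ℤ × ℕ → X → X) (ε : ℝ) (W : Set (ℤ × ℕ))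
    (M : Set X) : Prop :=
  ∀ x ∈ M, ∀ y ∈ M, x ≠ y → ∃ q ∈ W, ε ≤ d (Φ q x) (Φ q y)

/-- The largest cardinality of an `(ε, W)`-separated set. -/
def sepNumber {X : Type*} (d : X → X → ℝ) (Φ : ℤ × ℕ → X → X) (ε : ℝ) (W : Set (ℤ × ℕ)) : ℕ∞ :=
  ⨆ (M : Set X) (_ : IsSeparated d Φ ε W M), M.encard

/-- Topological directional entropy of `Φ` in the direction `(cos θ, sin θ)`:
`lim_{ε → 0} limsup_{w → ∞} limsup_{T → ∞} (1 / T) log N(ε, W(w, T, θ))`, with values in `[-∞, ∞]`.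
As `N` is nonincreasing in `ε`, the upper limit over `ε → 0+` is a limit. -/
def topDirEntropy {X : Type*} (d : X → X → ℝ) (Φ : ℤ × ℕ → X → X) (θ : ℝ) : EReal :=
  limsup (fun ε : ℝ =>
    limsup (fun w : ℝ =>
      limsup (fun T : ℝ =>
        ENNReal.log ((sepNumber d Φ ε (window w T θ) : ℕ∞) : ENNReal) / (T : EReal))
      atTop) atTop) (𝓝[>] 0)

/-- The topological directional entropy of the action on `(ZMod m) ^ ℤ` generated by the shift and
the linear automaton with coefficients `a_l, …, a_r`. -/
def dirEntropy (m : ℕ) (l r : ℤ) (a : ℤ → ℤ) (θ : ℝ) : EReal :=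
  topDirEntropy (configDist m) (action m l r a) θ

/-! ### The explicit formula -/

/-- `P = {0} ∪ {j ∈ [l, r] : gcd (a_j, p) = 1}`. -/
def unitIndices (l r : ℤ) (a : ℤ → ℤ) (p : ℕ) : Finset ℤ :=
  insert 0 ((Finset.Icc l r).filter fun j => Int.gcd (a j) p = 1)

/-- `L = min P`. -/
def leftIndex (l r : ℤ) (a : ℤ → ℤ) (p : ℕ) : ℤ :=
  (unitIndices l r a p).min' (Finset.insert_nonempty _ _)

/-- `R = max P`. -/
def rightIndex (l r : ℤ) (a : ℤ → ℤ) (p : ℕ) : ℤ :=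
  (unitIndices l r a p).max' (Finset.insert_nonempty _ _)

/-- The inverse cotangent with values in `(0, π)`. -/
def arccot (x : ℝ) : ℝ := Real.pi / 2 - Real.arctan x

/-- The three-piece function of `θ ∈ [0, π]` attached to a prime power `p ^ k` and to the extreme
indices `L ≤ R`; the pieces are `[0, arccot (-L)]`, `[arccot (-L), arccot (-R)]` and
`[arccot (-R), π]`. -/
def sectorTerm (p k : ℕ) (L R : ℤ) (θ : ℝ) : ℝ :=
  if θ ≤ arccot (-(L : ℝ)) then
    (k : ℝ) * |Real.cos θ + (R : ℝ) * Real.sin θ| * Real.log (p : ℝ)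
  else if θ ≤ arccot (-(R : ℝ)) then
    (k : ℝ) * |((R : ℝ) - (L : ℝ)) * Real.sin θ| * Real.log (p : ℝ)
  else
    (k : ℝ) * |Real.cos θ + (L : ℝ) * Real.sin θ| * Real.log (p : ℝ)

end LCA

end

/-!
By the Chinese remainder theorem a configuration modulo `m` is a family of configurations modulo the
`p ^ k ∥ m`, so `N(ε, W)` is bounded above by `∏ (p ^ k) ^ #J_p` whenever the orbit on a slightly
wider window is determined by the sites in `J_p`, and below by the same product whenever a
configuration supported in `J_p` is recovered from its orbit on `W`.

Upper bound: the coefficients outside `[L, R]` are divisible by `p`, so a nonzero contribution to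
`Φ^{(n,t)} x` uses fewer than `k` of them, and `(Φ^{(n,t)} x)_0` depends only on the sites within
`O(1)` of `[n + L t, n + R t]`. Over the window these intervals cover `T * sectorWidth L R θ + O(1)`
sites, where `sectorWidth L R θ = (cos θ + R sin θ)⁺ + (cos θ + L sin θ)⁻`.

Lower bound: first drop the coefficients outside `[L, R]`, descending through the powers of `p`.
Since `a_L` and `a_R` are units, the local rule can be solved for its extreme variables, so zeros
on a space-time strip of slope `cot θ` wider than the rule spread by `(cot θ + R)⁺` sites to the
right and `(cot θ + L)⁻` to the left per time step. A configuration supported on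
`T * sectorWidth L R θ - O(1)` suitable sites is thus recovered from its orbit on the window.

The signs of `cos θ + L sin θ ≤ cos θ + R sin θ` give the three sectors.
-/

noncomputable section

namespace LCA

section Correlation

variable {R : Type*} [CommRing R]

/-- The linear map `(correlation s a z) n = ∑_{j ∈ s} a_j z_{n+j}`, i.e. the global rule of the
linear cellular automaton over `R` with neighbourhood `s`. -/
def correlation (s : Finset ℤ) (a : ℤ → R) : (ℤ → R) →ₗ[R] (ℤ → R) :=
  ∑ j ∈ s, a j • LinearMap.funLeft R R (· + j)

theorem correlation_apply (s : Finset ℤ) (a z : ℤ → R) (n : ℤ) :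
    correlation s a z n = ∑ j ∈ s, a j * z (n + j) := by
  simp [correlation, LinearMap.funLeft_apply]

theorem correlation_pow_shift (s : Finset ℤ) (a : ℤ → R) (t : ℕ) (u : ℤ) (z : ℤ → R) :
    (correlation s a ^ t) (shift u z) = shift u ((correlation s a ^ t) z) := by
  have h : Function.Semiconj (shift u) (correlation s a) (correlation s a) := fun z => by
    ext n
    simp only [shift, correlation_apply, add_right_comm]
  simpa only [Module.End.coe_pow] using ((h.iterate_right t) z).symm

theorem map_correlation_pow {R' : Type*} [CommRing R'] (f : R →+* R') (s : Finset ℤ) (a : ℤ → R)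
    (t : ℕ) (z : ℤ → R) :
    f ∘ (correlation s a ^ t) z = (correlation s (f ∘ a) ^ t) (f ∘ z) := by
  have h : Function.Semiconj (f ∘ ·) (correlation s a) (correlation s (f ∘ a)) := fun z => by
    ext n
    simp only [Function.comp_apply, correlation_apply, map_sum, map_mul]
  simpa only [Module.End.coe_pow] using (h.iterate_right t) z

open Pointwise in
theorem correlation_pow_comp_neg (s : Finset ℤ) (a : ℤ → R) (t : ℕ) (z : ℤ → R) :
    (correlation s a ^ t) z ∘ Neg.neg =
      (correlation (-s) (a ∘ Neg.neg) ^ t) (z ∘ Neg.neg) := by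
  have h : Function.Semiconj (· ∘ Neg.neg) (correlation s a)
      (correlation (-s) (a ∘ Neg.neg)) := fun z => by
    ext n
    simp only [Function.comp_apply, correlation_apply, Finset.sum_neg_index, neg_neg, neg_add]
  simpa only [Module.End.coe_pow] using (h.iterate_right t) z

theorem correlation_sdiff_add_correlation {s s' : Finset ℤ} (hs : s' ⊆ s) (a z : ℤ → R) :
    correlation (s \ s') a z + correlation s' a z = correlation s a z := by
  rw [← LinearMap.add_apply, correlation, correlation, Finset.sum_sdiff hs, correlation]

theorem smul_correlation_eq_zero {s : Finset ℤ} {a z : ℤ → R} {c p : R} (ha : ∀ j ∈ s, p ∣ a j)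
    (hz : (c * p) • z = 0) : c • correlation s a z = 0 := by
  ext n
  rw [Pi.smul_apply, smul_eq_mul, correlation_apply, Finset.mul_sum]
  refine Finset.sum_eq_zero fun j hj => ?_
  obtain ⟨b, hb⟩ := ha j hj
  have hzj : c * p * z (n + j) = 0 := congrFun hz (n + j)
  rw [hb]
  linear_combination b * hzj

theorem correlation_pow_eq_of_smul_eq_zero {s s' : Finset ℤ} (hs : s' ⊆ s) {a z : ℤ → R} {p : R}
    (ha : ∀ j ∈ s, j ∉ s' → p ∣ a j) (hz : p • z = 0) (t : ℕ) :
    (correlation s a ^ t) z = (correlation s' a ^ t) z := by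
  induction t generalizing z with
  | zero => rfl
  | succ t ih =>
    have hdrop : correlation (s \ s') a z = 0 := by
      simpa using smul_correlation_eq_zero (c := 1)
        (fun j hj => ha j (Finset.mem_sdiff.1 hj).1 (Finset.mem_sdiff.1 hj).2) (by simpa using hz)
    have hstep : correlation s a z = correlation s' a z := by
      rw [← correlation_sdiff_add_correlation hs, hdrop, zero_add]
    simp only [pow_succ, Module.End.mul_apply]
    rw [hstep, ih (by rw [← map_smul, hz, map_zero])]

theorem correlation_eq_zero_of_forall {s : Finset ℤ} {a z : ℤ → R} {n : ℤ}
    (h : ∀ j ∈ s, z (n + j) = 0) : correlation s a z n = 0 := by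
  rw [correlation_apply]
  exact Finset.sum_eq_zero fun j hj => by rw [h j hj, mul_zero]

theorem correlation_pow_eq_zero_of_forall {s : Finset ℤ} {a : ℤ → R} {p : R} {L M : ℤ} {D : ℕ}
    (hs : s ⊆ Finset.Icc (L - D) (M + D)) (ha : ∀ j ∈ s, j ∉ Finset.Icc L M → p ∣ a j)
    {t k : ℕ} {z : ℤ → R} (hz : p ^ k • z = 0) {n : ℤ}
    (h0 : ∀ i ∈ Finset.Icc (n + L * t - k * D) (n + M * t + k * D), z i = 0) :
    (correlation s a ^ t) z n = 0 := by
  -- A step outside `[L, M]` costs a factor `p`, so fewer than `k` such steps matter.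
  simp only [Finset.mem_Icc] at h0
  induction t generalizing k z with
  | zero => exact h0 n (by push_cast; constructor <;> nlinarith)
  | succ t ih =>
    have hnear : (correlation s a ^ t) (correlation (s ∩ Finset.Icc L M) a z) n = 0 := by
      refine ih (by rw [← map_smul, hz, map_zero]) fun i hi =>
        correlation_eq_zero_of_forall fun j hj => h0 _ ?_
      have hj := Finset.mem_Icc.1 (Finset.mem_inter.1 hj).2
      push_cast
      constructor <;> linarith
    have hfar : (correlation s a ^ t) (correlation (s \ (s ∩ Finset.Icc L M)) a z) n = 0 := by
      rcases k with _ | k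
      · have hz0 : z = 0 := by simpa using hz
        simp [hz0]
      refine ih (smul_correlation_eq_zero (p := p) (fun j hj => ?_)
        (pow_succ p k ▸ hz)) fun i hi => correlation_eq_zero_of_forall fun j hj => h0 _ ?_
      · rw [Finset.sdiff_inter_self_left, Finset.mem_sdiff] at hj
        exact ha j hj.1 hj.2
      · have hj := Finset.mem_Icc.1 (hs (Finset.mem_sdiff.1 hj).1)
        push_cast
        constructor <;> linarith
    rw [pow_succ, Module.End.mul_apply,
      ← correlation_sdiff_add_correlation Finset.inter_subset_left, map_add, Pi.add_apply, hfar,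
      hnear, add_zero]

theorem eq_zero_of_correlation_eq_zero {s : Finset ℤ} {a : ℤ → R} {M : ℤ} (hM : M ∈ s)
    (hmax : ∀ j ∈ s, j ≤ M) (hu : IsUnit (a M)) {S : Set ℤ} (hS : BddBelow S) {z : ℤ → R}
    (h : ∀ n ∈ S, z n = 0 ∨
      correlation s a z (n - M) = 0 ∧ ∀ j ∈ s, j ≠ M → n - M + j ∈ S) :
    ∀ n ∈ S, z n = 0 := by
  by_contra! hne
  obtain ⟨B, hB⟩ := hS
  obtain ⟨n, ⟨hnS, hn⟩, hmin⟩ := Int.exists_least_of_bdd (P := fun n => n ∈ S ∧ z n ≠ 0)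
    ⟨B, fun n hn => hB hn.1⟩ hne
  obtain ⟨hF, hj⟩ := (h n hnS).resolve_left hn
  have hsum : correlation s a z (n - M) = a M * z n := by
    rw [correlation_apply, Finset.sum_eq_single_of_mem M hM fun j hjs hjM => ?_, sub_add_cancel]
    by_contra hne
    have hle := hmin _ ⟨hj j hjs hjM, right_ne_zero_of_mul hne⟩
    have hlt := (hmax j hjs).lt_of_ne hjM
    omega
  exact hn (hu.mul_right_eq_zero.1 (hsum ▸ hF))

/-! ### Vanishing on a space-time strip -/

section Strip

variable {s : Finset ℤ} {a : ℤ → R} {L M : ℤ} {w c : ℝ}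

theorem eq_zero_right_of_strip (hs : s ⊆ Finset.Icc L M) (hM : M ∈ s) (hu : IsUnit (a M))
    (hw : M - L < 2 * w) (hwM : c + M < 2 * w) {N : ℕ} {b : ℝ} {z : ℤ → R}
    (h0 : ∀ t ≤ N, ∀ n : ℤ, |n - (b + t * c)| < w → (correlation s a ^ t) z n = 0) (n : ℤ)
    (hn : b - w < n) (hn' : n < b + w + N * (c + M)) : z n = 0 := by
  induction N generalizing b z n with
  | zero => exact h0 0 le_rfl n (by rw [abs_lt]; push_cast at hn' ⊢; constructor <;> linarith)
  | succ N ih =>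
    have hF : ∀ n : ℤ, b + c - w < n → n < b + c + w + N * (c + M) → correlation s a z n = 0 :=
      fun n => ih (b := b + c) (fun t ht n hn => by
        rw [← Module.End.mul_apply, ← pow_succ]
        refine h0 (t + 1) (by omega) n ?_
        push_cast
        rwa [add_one_mul, add_comm (t * c), ← add_assoc]) n
    refine eq_zero_of_correlation_eq_zero hM (fun j hj => (Finset.mem_Icc.1 (hs hj)).2) hu
      (S := {n : ℤ | b - w < n ∧ n < b + w + (N + 1 : ℕ) * (c + M)})
      ⟨⌊b - w⌋, fun n hn => (Int.floor_lt.2 hn.1).le⟩ (fun n hn => ?_) n ⟨hn, hn'⟩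
    obtain ⟨hn, hn'⟩ := hn
    push_cast at hn'
    rcases lt_or_ge (n : ℝ) (b + w) with hnw | hnw
    · refine .inl (h0 0 (Nat.zero_le _) n ?_)
      rw [abs_lt]
      push_cast
      constructor <;> linarith
    · refine .inr ⟨hF _ (by push_cast; linarith) (by push_cast; linarith), fun j hj _ => ?_⟩
      obtain ⟨hLj, hjM⟩ := Finset.mem_Icc.1 (hs hj)
      have hLj : (L : ℝ) ≤ j := by exact_mod_cast hLj
      have hjM : (j : ℝ) ≤ M := by exact_mod_cast hjM
      constructor <;> push_cast <;> linarith

open Pointwise in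
theorem eq_zero_left_of_strip (hs : s ⊆ Finset.Icc L M) (hL : L ∈ s) (hu : IsUnit (a L))
    (hw : M - L < 2 * w) (hwL : -(c + L) < 2 * w) {N : ℕ} {b : ℝ} {z : ℤ → R}
    (h0 : ∀ t ≤ N, ∀ n : ℤ, |n - (b + t * c)| < w → (correlation s a ^ t) z n = 0) (n : ℤ)
    (hn : b - w + N * (c + L) < n) (hn' : n < b + w) : z n = 0 := by
  have hs' : -s ⊆ Finset.Icc (-M) (-L) := fun j hj => by
    have := Finset.mem_Icc.1 (hs (Finset.mem_neg'.1 hj))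
    exact Finset.mem_Icc.2 (by omega)
  have h := eq_zero_right_of_strip (a := a ∘ Neg.neg) (w := w) (c := -c) (b := -b) (N := N)
    (z := z ∘ Neg.neg) hs' (by simpa using hL) (by simpa using hu)
    (by push_cast; linarith) (by push_cast; linarith) (fun t ht n hn => ?_) (-n)
    (by push_cast; linarith) (by push_cast; linarith)
  · simpa using h
  · rw [← correlation_pow_comp_neg]
    refine h0 t ht (-n) ?_
    rw [← abs_neg]
    convert hn using 2
    push_cast
    ring

theorem eq_zero_of_strip (hs : s ⊆ Finset.Icc L M) (hL : L ∈ s) (hM : M ∈ s)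
    (huL : IsUnit (a L)) (huM : IsUnit (a M)) (hw : M - L < 2 * w) (hwL : -(c + L) < 2 * w)
    (hwM : c + M < 2 * w) {N : ℕ} {b : ℝ} {z : ℤ → R}
    (h0 : ∀ t ≤ N, ∀ n : ℤ, |n - (b + t * c)| < w → (correlation s a ^ t) z n = 0) (n : ℤ)
    (hn : b - w - N * max (-(c + L)) 0 < n) (hn' : n < b + w + N * max (c + M) 0) : z n = 0 := by
  have hLM : (L : ℝ) ≤ M := by exact_mod_cast (Finset.mem_Icc.1 (hs hL)).2
  have hcenter : b - w < n → n < b + w → z n = 0 := fun h h' =>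
    h0 0 (Nat.zero_le _) n (by rw [abs_lt]; push_cast; constructor <;> linarith)
  rcases le_or_gt (n : ℝ) (b - w) with hleft | hleft
  · rcases max_choice (-(c + L)) 0 with h | h <;> rw [h] at hn
    · exact eq_zero_left_of_strip hs hL huL hw hwL h0 n (by linarith) (by linarith)
    · linarith
  · rcases max_choice (c + M) 0 with h | h <;> rw [h] at hn'
    · exact eq_zero_right_of_strip hs hM huM hw hwM h0 n hleft hn'
    · exact hcenter hleft (by linarith)

theorem eq_zero_of_support_Ioo (hs : s ⊆ Finset.Icc L M) (hM : M ∈ s) (hu : IsUnit (a M))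
    {lo hi : ℝ} {z : ℤ → R} (hz : ∀ n : ℤ, z n ≠ 0 → lo + M < n ∧ n < hi + M)
    (hF : ∀ n : ℤ, lo < n → n < hi → correlation s a z n = 0) : z = 0 := by
  have hzero : ∀ n : ℤ, lo + L < n → z n = 0 := by
    refine eq_zero_of_correlation_eq_zero hM (fun j hj => (Finset.mem_Icc.1 (hs hj)).2) hu
      (S := {n : ℤ | lo + L < n}) ⟨⌊lo + L⌋, fun n hn => (Int.floor_lt.2 hn).le⟩ fun n _ =>
      or_iff_not_imp_left.2 fun hn => ?_
    obtain ⟨hlo, hhi⟩ := hz n hn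
    refine ⟨hF _ (by push_cast; linarith) (by push_cast; linarith), fun j hj _ => ?_⟩
    have hLj : (L : ℝ) ≤ j := by exact_mod_cast (Finset.mem_Icc.1 (hs hj)).1
    rw [Set.mem_ofPred_eq]
    push_cast
    linarith
  have hLM : (L : ℝ) ≤ M := by exact_mod_cast (Finset.mem_Icc.1 (hs hM)).1
  exact funext fun n => by_contra fun hn => hn (hzero n (by linarith [(hz n hn).1]))

end Strip

end Correlation

/-! ### Windows -/

section Window

variable {w T θ : ℝ}

/-- The growth rate in `T` of the width of the union of the domains of dependence
`[n + L t, n + M t]` of the points `(n, t)` of `window w T θ`. -/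
def sectorWidth (L M : ℤ) (θ : ℝ) : ℝ :=
  max (Real.cos θ + M * Real.sin θ) 0 + max (-(Real.cos θ + L * Real.sin θ)) 0

theorem sectorWidth_nonneg (L M : ℤ) (θ : ℝ) : 0 ≤ sectorWidth L M θ :=
  add_nonneg (le_max_right _ _) (le_max_right _ _)

theorem add_mul_lt_of_mem_window (c : ℝ) {q : ℤ × ℕ} (hq : q ∈ window w T θ) :
    q.1 + c * q.2 < w + T * max (Real.cos θ + c * Real.sin θ) 0 := by
  obtain ⟨x, y, -, hx, hy, hyT, hn, ht⟩ := hq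
  have hmul : y * (Real.cos θ + c * Real.sin θ) ≤ T * max (Real.cos θ + c * Real.sin θ) 0 :=
    (mul_le_mul_of_nonneg_left (le_max_left _ _) hy.le).trans
      (mul_le_mul_of_nonneg_right hyT (le_max_right _ _))
  rw [hn, ht]
  linarith

theorem lt_add_mul_of_mem_window (c : ℝ) {q : ℤ × ℕ} (hq : q ∈ window w T θ) :
    -w - T * max (-(Real.cos θ + c * Real.sin θ)) 0 < q.1 + c * q.2 := by
  obtain ⟨x, y, hx, -, hy, hyT, hn, ht⟩ := hq
  have hmul : y * -(Real.cos θ + c * Real.sin θ) ≤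
      T * max (-(Real.cos θ + c * Real.sin θ)) 0 :=
    (mul_le_mul_of_nonneg_left (le_max_left _ _) hy.le).trans
      (mul_le_mul_of_nonneg_right hyT (le_max_right _ _))
  rw [hn, ht]
  linarith

theorem add_mem_window {K : ℝ} {q : ℤ × ℕ} (hq : q ∈ window w T θ) {i : ℤ} (hi : |(i : ℝ)| ≤ K) :
    (i + q.1, q.2) ∈ window (w + K) T θ := by
  obtain ⟨x, y, hx, hx', hy, hyT, hn, ht⟩ := hq
  obtain ⟨hi, hi'⟩ := abs_le.1 hi
  refine ⟨i + x, y, by linarith, by linarith, hy, hyT, ?_, ht⟩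
  push_cast
  rw [hn, add_assoc]

theorem mem_window_of_sin_pos (hθ : 0 < Real.sin θ) {n : ℤ} {t : ℕ} (ht : 0 < t)
    (htT : t ≤ T * Real.sin θ) (hn : |n - t * (Real.cos θ / Real.sin θ)| < w) :
    (n, t) ∈ window w T θ := by
  obtain ⟨hn, hn'⟩ := abs_lt.1 hn
  refine ⟨_, t / Real.sin θ, hn, hn', by positivity, (div_le_iff₀ hθ).2 htT, ?_, ?_⟩ <;> field_simp
  ring

theorem mem_Ioo_floor_ceil {x y : ℝ} {i : ℤ} : i ∈ Finset.Ioo ⌊x⌋ ⌈y⌉ ↔ x < i ∧ i < y := by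
  rw [Finset.mem_Ioo, Int.floor_lt, Int.lt_ceil]

theorem sub_one_le_card_Ioo_floor_ceil (x y : ℝ) : y - x - 1 ≤ (Finset.Ioo ⌊x⌋ ⌈y⌉).card := by
  have hcard : ((⌈y⌉ - ⌊x⌋ - 1 : ℤ) : ℝ) ≤ (Finset.Ioo ⌊x⌋ ⌈y⌉).card := by
    rw [Int.card_Ioo]
    exact_mod_cast Int.self_le_toNat _
  push_cast at hcard
  linarith [Int.floor_le x, Int.le_ceil y]

theorem card_Ioo_floor_ceil_le {x y : ℝ} (h : 0 ≤ y - x + 1) :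
    (Finset.Ioo ⌊x⌋ ⌈y⌉).card ≤ y - x + 1 := by
  rw [Int.card_Ioo, ← Int.cast_natCast, Int.toNat_eq_max, Int.cast_max]
  refine max_le ?_ (by exact_mod_cast h)
  push_cast
  linarith [Int.sub_one_lt_floor x, Int.ceil_lt_add_one y]

end Window

/-! ### Sites recovering or determining an orbit -/

section DetectsDetermines

variable {R : Type*} [CommRing R] {s : Finset ℤ} {a : ℤ → R} {L M : ℤ} {w θ : ℝ}

/-- A configuration supported in `J` is recovered from its orbit on the lattice points of `W`;
yields separated sets. -/
def Detects (s : Finset ℤ) (a : ℤ → R) (W : Set (ℤ × ℕ)) (J : Finset ℤ) : Prop :=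
  ∀ z : ℤ → R, (∀ i ∉ J, z i = 0) → (∀ q ∈ W, (correlation s a ^ q.2) z q.1 = 0) → z = 0

/-- The restriction of a configuration to `J` determines its orbit on the lattice points of `W`;
bounds the size of separated sets. -/
def Determines (s : Finset ℤ) (a : ℤ → R) (W : Set (ℤ × ℕ)) (J : Finset ℤ) : Prop :=
  ∀ z : ℤ → R, (∀ i ∈ J, z i = 0) → ∀ q ∈ W, (correlation s a ^ q.2) z q.1 = 0

theorem Detects.of_dvd {s' : Finset ℤ} (hs : s' ⊆ s) {p : R} {k : ℕ} (hp : p ^ k = 0)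
    (ha : ∀ j ∈ s, j ∉ s' → p ∣ a j) {W : Set (ℤ × ℕ)} {J : Finset ℤ} (h : Detects s' a W J) :
    Detects s a W J := by
  intro z hz h0
  have descend : ∀ i, p ^ (i + 1) • z = 0 → p ^ i • z = 0 := fun i hi =>
    h _ (fun j hj => by rw [Pi.smul_apply, hz j hj, smul_zero]) fun q hq => by
      rw [← correlation_pow_eq_of_smul_eq_zero hs ha (by rw [smul_smul, ← pow_succ', hi]),
        map_smul, Pi.smul_apply, h0 q hq, smul_zero]
  have hzero : p ^ 0 • z = 0 :=
    Nat.decreasingInduction (motive := fun i _ => p ^ i • z = 0) (fun i _ => descend i)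
      (by rw [hp, zero_smul]) (Nat.zero_le k)
  simpa using hzero

theorem detects_of_forall_mem {W : Set (ℤ × ℕ)} {J : Finset ℤ} (h : ∀ j ∈ J, (j, 0) ∈ W) :
    Detects s a W J := fun z hz h0 => funext fun i => by
  by_cases hi : i ∈ J
  · exact h0 (i, 0) (h i hi)
  · exact hz i hi

theorem exists_detects_of_sin_eq_zero (hθ : Real.sin θ = 0) (hw : 0 < w) (T : ℝ) :
    ∃ J : Finset ℤ, T * sectorWidth L M θ - 1 ≤ J.card ∧ Detects s a (window w T θ) J := by
  refine ⟨Finset.Ioo ⌊-(T * max (-Real.cos θ) 0)⌋ ⌈T * max (Real.cos θ) 0⌉, ?_,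
    detects_of_forall_mem fun n hn => ?_⟩
  · refine le_trans (le_of_eq ?_) (sub_one_le_card_Ioo_floor_ceil _ _)
    simp only [sectorWidth, hθ, mul_zero, add_zero]
    ring
  · obtain ⟨hn, hn'⟩ := mem_Ioo_floor_ceil.1 hn
    refine ⟨0, n * Real.cos θ, by linarith, hw, ?_⟩
    rcases Real.sin_eq_zero_iff_cos_eq.1 hθ with hcos | hcos <;>
      norm_num [hcos] at hn hn' <;> norm_num [hcos, hθ, hn, hn'] <;> linarith

theorem sectorWidth_eq_of_sin_pos (hθ : 0 < Real.sin θ) :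
    sectorWidth L M θ = Real.sin θ * (max (Real.cos θ / Real.sin θ + M) 0 +
      max (-(Real.cos θ / Real.sin θ + L)) 0) := by
  rw [mul_add, mul_max_of_nonneg _ _ hθ.le, mul_max_of_nonneg _ _ hθ.le, mul_zero,
    sectorWidth]
  field_simp

theorem exists_detects_of_sin_pos (hs : s ⊆ Finset.Icc L M) (hL : L ∈ s) (hM : M ∈ s)
    (huL : IsUnit (a L)) (huM : IsUnit (a M)) (hθ : 0 < Real.sin θ) (hw : M - L < 2 * w)
    (hwL : -(Real.cos θ / Real.sin θ + L) < 2 * w) (hwM : Real.cos θ / Real.sin θ + M < 2 * w)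
    {T : ℝ} (hT : 1 ≤ T * Real.sin θ) :
    ∃ J : Finset ℤ, T * sectorWidth L M θ - (2 * (sectorWidth L M θ / Real.sin θ) + 1) ≤ J.card ∧
      Detects s a (window w T θ) J := by
  have hwidth : sectorWidth L M θ / Real.sin θ = max (Real.cos θ / Real.sin θ + M) 0 +
      max (-(Real.cos θ / Real.sin θ + L)) 0 := by
    rw [sectorWidth_eq_of_sin_pos hθ, mul_div_cancel_left₀ _ hθ.ne']
  set c := Real.cos θ / Real.sin θ
  obtain ⟨N, hN⟩ := Nat.exists_eq_add_of_le' ((Nat.one_le_floor_iff _).2 hT)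
  have hNT : ((N + 1 : ℕ) : ℝ) ≤ T * Real.sin θ := hN ▸ Nat.floor_le (by linarith)
  have hTN : T * Real.sin θ < N + 2 := by
    have := Nat.lt_floor_add_one (T * Real.sin θ)
    rw [hN] at this
    push_cast at this
    linarith
  set lo := c - w - N * max (-(c + L)) 0 with hlo
  set hi := c + w + N * max (c + M) 0 with hhi
  refine ⟨Finset.Ioo ⌊lo + M⌋ ⌈hi + M⌉, ?_, fun z hz h0 => ?_⟩
  · refine le_trans ?_ (sub_one_le_card_Ioo_floor_ceil _ _)
    have hgrow : (T * Real.sin θ - 2) * (sectorWidth L M θ / Real.sin θ) ≤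
        N * (sectorWidth L M θ / Real.sin θ) :=
      mul_le_mul_of_nonneg_right (by linarith) (div_nonneg (sectorWidth_nonneg _ _ _) hθ.le)
    rw [sub_mul, mul_assoc, mul_div_cancel₀ _ hθ.ne', hwidth] at hgrow
    have hLM : (L : ℝ) ≤ M := by exact_mod_cast (Finset.mem_Icc.1 (hs hL)).2
    rw [hwidth, hlo, hhi]
    linarith
  · have hF : ∀ n : ℤ, lo < n → n < hi → correlation s a z n = 0 :=
      eq_zero_of_strip hs hL hM huL huM hw hwL hwM fun t ht n hn => by
        rw [← Module.End.mul_apply, ← pow_succ]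
        refine h0 (n, t + 1) (mem_window_of_sin_pos hθ t.succ_pos
          (le_trans (by exact_mod_cast Nat.succ_le_succ ht) hNT) ?_)
        convert hn using 2
        push_cast
        ring
    exact eq_zero_of_support_Ioo hs hM huM
      (fun n hn => mem_Ioo_floor_ceil.1 (not_imp_comm.1 (hz n) hn)) hF

theorem exists_detects (hs : s ⊆ Finset.Icc L M) (hL : L ∈ s) (hM : M ∈ s)
    (huL : IsUnit (a L)) (huM : IsUnit (a M)) (hθ : θ ∈ Set.Icc 0 Real.pi) :
    ∃ C : ℝ, ∀ᶠ w in atTop, ∀ᶠ T in atTop, ∃ J : Finset ℤ,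
      T * sectorWidth L M θ - C ≤ J.card ∧ Detects s a (window w T θ) J := by
  rcases (Real.sin_nonneg_of_mem_Icc hθ).eq_or_lt with hsin | hsin
  · refine ⟨1, ?_⟩
    filter_upwards [eventually_gt_atTop 0] with w hw
    exact .of_forall (exists_detects_of_sin_eq_zero hsin.symm hw)
  · have htwo : Tendsto (fun w : ℝ => 2 * w) atTop atTop :=
      tendsto_id.const_mul_atTop two_pos
    refine ⟨2 * (sectorWidth L M θ / Real.sin θ) + 1, ?_⟩
    filter_upwards [htwo.eventually_gt_atTop _, htwo.eventually_gt_atTop _,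
      htwo.eventually_gt_atTop _] with w hw hwL hwM
    filter_upwards [(tendsto_id.atTop_mul_const hsin).eventually_ge_atTop 1] with T hT
    exact exists_detects_of_sin_pos hs hL hM huL huM hsin hw hwL hwM hT

theorem exists_subset_Icc_sub_add (s : Finset ℤ) (L M : ℤ) :
    ∃ D : ℕ, s ⊆ Finset.Icc (L - D) (M + D) := by
  refine ⟨s.sup fun j => (L - j).toNat ⊔ (j - M).toNat, fun j hj => Finset.mem_Icc.2 ?_⟩
  have := Finset.le_sup (f := fun j => (L - j).toNat ⊔ (j - M).toNat) hj
  omega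

theorem exists_determines {p : R} {k : ℕ} (hp : p ^ k = 0)
    (ha : ∀ j ∈ s, j ∉ Finset.Icc L M → p ∣ a j) (hw : 0 ≤ w) :
    ∃ C : ℝ, ∀ T ≥ 0, ∃ J : Finset ℤ,
      J.card ≤ T * sectorWidth L M θ + C ∧ Determines s a (window w T θ) J := by
  obtain ⟨D, hD⟩ := exists_subset_Icc_sub_add s L M
  refine ⟨2 * w + 2 * k * D + 1, fun T hT => ?_⟩
  set lo := -w - T * max (-(Real.cos θ + L * Real.sin θ)) 0 - k * D with hlo
  set hi := w + T * max (Real.cos θ + M * Real.sin θ) 0 + k * D with hhi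
  have hwidth : hi - lo + 1 = T * sectorWidth L M θ + (2 * w + 2 * k * D + 1) := by
    rw [hlo, hhi, sectorWidth]
    ring
  have hnonneg : 0 ≤ T * sectorWidth L M θ := mul_nonneg hT (sectorWidth_nonneg L M θ)
  refine ⟨Finset.Ioo ⌊lo⌋ ⌈hi⌉,
    hwidth ▸ card_Ioo_floor_ceil_le (by rw [hwidth]; positivity), fun z hz q hq => ?_⟩
  refine correlation_pow_eq_zero_of_forall hD ha (by rw [hp, zero_smul]) fun i hi =>
    hz i (mem_Ioo_floor_ceil.2 ?_)
  have hleft := lt_add_mul_of_mem_window L hq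
  have hright := add_mul_lt_of_mem_window M hq
  obtain ⟨hi, hi'⟩ := Finset.mem_Icc.1 hi
  have hi : (q.1 + L * q.2 - k * D : ℝ) ≤ i := by exact_mod_cast hi
  have hi' : (i : ℝ) ≤ q.1 + M * q.2 + k * D := by exact_mod_cast hi'
  constructor <;> linarith

end DetectsDetermines

/-! ### The three sectors -/

theorem cos_sub_arctan (x θ : ℝ) : Real.cos (θ - Real.arctan x) =
    Real.cos (Real.arctan x) * (Real.cos θ + x * Real.sin θ) := by
  have h : Real.sin (Real.arctan x) = x * Real.cos (Real.arctan x) := by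
    have := Real.tan_mul_cos (Real.cos_arctan_pos x).ne'
    rw [Real.tan_arctan] at this
    exact this.symm
  rw [Real.cos_sub, h]
  ring

theorem nonneg_of_le_arccot {x θ : ℝ} (hθ : θ ∈ Set.Icc 0 Real.pi) (h : θ ≤ arccot (-x)) :
    0 ≤ Real.cos θ + x * Real.sin θ := by
  rw [arccot, Real.arctan_neg] at h
  have h1 := Real.arctan_lt_pi_div_two x
  refine nonneg_of_mul_nonneg_right (b := Real.cos θ + x * Real.sin θ) ?_ (Real.cos_arctan_pos x)
  rw [← cos_sub_arctan]
  exact Real.cos_nonneg_of_mem_Icc ⟨by linarith [hθ.1], by linarith⟩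

theorem nonpos_of_arccot_le {x θ : ℝ} (hθ : θ ∈ Set.Icc 0 Real.pi) (h : arccot (-x) ≤ θ) :
    Real.cos θ + x * Real.sin θ ≤ 0 := by
  rw [arccot, Real.arctan_neg] at h
  have h1 := Real.neg_pi_div_two_lt_arctan x
  have h2 : Real.cos (θ - Real.arctan x) ≤ 0 :=
    Real.cos_nonpos_of_pi_div_two_le_of_le (by linarith) (by linarith [hθ.2])
  rw [cos_sub_arctan] at h2
  exact nonpos_of_mul_nonpos_right h2 (Real.cos_arctan_pos x)

section Sector

variable {L M : ℤ} {θ : ℝ}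

theorem cos_add_le_cos_add (hLM : L ≤ M) (hθ : θ ∈ Set.Icc 0 Real.pi) :
    Real.cos θ + L * Real.sin θ ≤ Real.cos θ + M * Real.sin θ := by
  have : (L : ℝ) * Real.sin θ ≤ M * Real.sin θ :=
    mul_le_mul_of_nonneg_right (by exact_mod_cast hLM) (Real.sin_nonneg_of_mem_Icc hθ)
  linarith

theorem sectorWidth_of_le_left (hLM : L ≤ M) (hθ : θ ∈ Set.Icc 0 Real.pi)
    (h : θ ≤ arccot (-(L : ℝ))) : sectorWidth L M θ = |Real.cos θ + M * Real.sin θ| := by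
  have h1 := nonneg_of_le_arccot hθ h
  have h2 := h1.trans (cos_add_le_cos_add hLM hθ)
  rw [sectorWidth, max_eq_left h2, max_eq_right (by linarith), add_zero, abs_of_nonneg h2]

theorem sectorWidth_of_mid (hθ : θ ∈ Set.Icc 0 Real.pi)
    (h : arccot (-(L : ℝ)) ≤ θ) (h' : θ ≤ arccot (-(M : ℝ))) :
    sectorWidth L M θ = |((M : ℝ) - L) * Real.sin θ| := by
  have h1 := nonpos_of_arccot_le hθ h
  have h2 := nonneg_of_le_arccot hθ h'
  rw [sectorWidth, max_eq_left h2, max_eq_left (by linarith), abs_of_nonneg (by linarith)]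
  ring

theorem sectorWidth_of_right_le (hLM : L ≤ M) (hθ : θ ∈ Set.Icc 0 Real.pi)
    (h : arccot (-(M : ℝ)) ≤ θ) : sectorWidth L M θ = |Real.cos θ + L * Real.sin θ| := by
  have h1 := nonpos_of_arccot_le hθ h
  have h2 := (cos_add_le_cos_add hLM hθ).trans h1
  rw [sectorWidth, max_eq_right h1, max_eq_left (by linarith), zero_add, abs_of_nonpos h2]

theorem sectorTerm_eq (hLM : L ≤ M) (hθ : θ ∈ Set.Icc 0 Real.pi) (p k : ℕ) :
    sectorTerm p k L M θ = k * sectorWidth L M θ * Real.log p := by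
  unfold sectorTerm
  split_ifs with h1 h2
  · rw [sectorWidth_of_le_left hLM hθ h1]
  · rw [sectorWidth_of_mid hθ (not_le.1 h1).le h2]
  · rw [sectorWidth_of_right_le hLM hθ (not_le.1 h2).le]

end Sector

/-! ### Extreme unit coefficients -/

/-- The rule is left and right permutative: permutative in some variable `x_j` with `j ≤ 0` and in
some variable `x_j` with `0 ≤ j`. -/
def IsBipermutative (m : ℕ) (l r : ℤ) (a : ℤ → ℤ) : Prop :=
  (∃ j : Finset.Icc l r, (j : ℤ) ≤ 0 ∧ PermutativeIn (localRule m l r a) j) ∧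
    ∃ j : Finset.Icc l r, 0 ≤ (j : ℤ) ∧ PermutativeIn (localRule m l r a) j

theorem PermutativeIn.isUnit {m : ℕ} {l r : ℤ} {a : ℤ → ℤ} {j : Finset.Icc l r}
    (h : PermutativeIn (localRule m l r a) j) : IsUnit (a j : ZMod m) := by
  obtain ⟨c, hc⟩ := (h 0).surjective 1
  have hrule : localRule m l r a (Function.update 0 j c) = a j * c := by
    rw [localRule, Finset.sum_eq_single_of_mem j (Finset.mem_univ j)]
    · rw [Function.update_self]
    · intro i _ hij
      rw [Function.update_of_ne hij, Pi.zero_apply, mul_zero]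
  exact .of_mul_eq_one c (hrule ▸ hc)

section Indices

variable {l r : ℤ} {a : ℤ → ℤ} {p k : ℕ}

theorem isUnit_intCast_pow_iff (hk : k ≠ 0) (b : ℤ) :
    IsUnit (b : ZMod (p ^ k)) ↔ Int.gcd b p = 1 := by
  rw [ZMod.coe_int_isUnit_iff_isCoprime, isCoprime_comm, Nat.cast_pow,
    IsCoprime.pow_right_iff (Nat.pos_of_ne_zero hk), Int.isCoprime_iff_gcd_eq_one]

theorem mem_unitIndices {j : ℤ} :
    j ∈ unitIndices l r a p ↔ j = 0 ∨ j ∈ Finset.Icc l r ∧ Int.gcd (a j) p = 1 := by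
  rw [unitIndices, Finset.mem_insert, Finset.mem_filter]

theorem leftIndex_mem (l r : ℤ) (a : ℤ → ℤ) (p : ℕ) : leftIndex l r a p ∈ unitIndices l r a p :=
  Finset.min'_mem _ _

theorem rightIndex_mem (l r : ℤ) (a : ℤ → ℤ) (p : ℕ) :
    rightIndex l r a p ∈ unitIndices l r a p :=
  Finset.max'_mem _ _

theorem unitIndices_subset_Icc (l r : ℤ) (a : ℤ → ℤ) (p : ℕ) :
    unitIndices l r a p ⊆ Finset.Icc (leftIndex l r a p) (rightIndex l r a p) := fun j hj =>
  Finset.mem_Icc.2 ⟨Finset.min'_le _ j hj, Finset.le_max' _ j hj⟩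

theorem leftIndex_le_rightIndex (l r : ℤ) (a : ℤ → ℤ) (p : ℕ) :
    leftIndex l r a p ≤ rightIndex l r a p :=
  Finset.min'_le _ _ (rightIndex_mem l r a p)

theorem PermutativeIn.mem_unitIndices (hk : k ≠ 0) {j : Finset.Icc l r}
    (hj : PermutativeIn (localRule (p ^ k) l r a) j) : (j : ℤ) ∈ unitIndices l r a p :=
  LCA.mem_unitIndices.2 (.inr ⟨j.2, (isUnit_intCast_pow_iff hk _).1 hj.isUnit⟩)

theorem PermutativeIn.mem_Icc_and_isUnit (hk : k ≠ 0) {j : Finset.Icc l r}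
    (hj : PermutativeIn (localRule (p ^ k) l r a) j) {i : ℤ} (hi : i ∈ unitIndices l r a p)
    (hij : i = 0 → i = j) : i ∈ Finset.Icc l r ∧ IsUnit (a i : ZMod (p ^ k)) := by
  rcases LCA.mem_unitIndices.1 hi with h0 | ⟨hmem, hgcd⟩
  · exact hij h0 ▸ ⟨j.2, hj.isUnit⟩
  · exact ⟨hmem, (isUnit_intCast_pow_iff hk _).2 hgcd⟩

theorem IsBipermutative.leftIndex_spec (hk : k ≠ 0) (h : IsBipermutative (p ^ k) l r a) :
    leftIndex l r a p ∈ Finset.Icc l r ∧ IsUnit (a (leftIndex l r a p) : ZMod (p ^ k)) := by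
  obtain ⟨⟨j, hj0, hj⟩, -⟩ := h
  have hle : leftIndex l r a p ≤ j := Finset.min'_le _ _ (hj.mem_unitIndices hk)
  exact hj.mem_Icc_and_isUnit hk (leftIndex_mem l r a p) (by omega)

theorem IsBipermutative.rightIndex_spec (hk : k ≠ 0) (h : IsBipermutative (p ^ k) l r a) :
    rightIndex l r a p ∈ Finset.Icc l r ∧ IsUnit (a (rightIndex l r a p) : ZMod (p ^ k)) := by
  obtain ⟨-, j, hj0, hj⟩ := h
  have hle : j ≤ rightIndex l r a p := Finset.le_max' _ _ (hj.mem_unitIndices hk)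
  exact hj.mem_Icc_and_isUnit hk (rightIndex_mem l r a p) (by omega)

theorem dvd_of_notMem_Icc_leftIndex_rightIndex (hp : p.Prime) (k : ℕ) {j : ℤ}
    (hj : j ∈ Finset.Icc l r)
    (hj' : j ∉ Finset.Icc (leftIndex l r a p) (rightIndex l r a p)) :
    (p : ZMod (p ^ k)) ∣ (a j : ZMod (p ^ k)) := by
  have hgcd : Int.gcd (a j) p ≠ 1 := fun h =>
    hj' (unitIndices_subset_Icc l r a p (mem_unitIndices.2 (.inr ⟨hj, h⟩)))
  have hdvd : (p : ℤ) ∣ a j := by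
    rw [Ne, ← Int.isCoprime_iff_gcd_eq_one, isCoprime_comm,
      (Nat.prime_iff_prime_int.1 hp).coprime_iff_not_dvd, not_not] at hgcd
    exact hgcd
  simpa using map_dvd (Int.castRingHom (ZMod (p ^ k))) hdvd

theorem natCast_pow_eq_zero (p k : ℕ) : (p : ZMod (p ^ k)) ^ k = 0 := by
  rw [← Nat.cast_pow, ZMod.natCast_self]

variable {θ : ℝ}

theorem IsBipermutative.exists_detects (hp : p.Prime) (hk : k ≠ 0)
    (h : IsBipermutative (p ^ k) l r a) (hθ : θ ∈ Set.Icc 0 Real.pi) :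
    ∃ C : ℝ, ∀ᶠ w in atTop, ∀ᶠ T in atTop, ∃ J : Finset ℤ,
      T * sectorWidth (leftIndex l r a p) (rightIndex l r a p) θ - C ≤ J.card ∧
      Detects (Finset.Icc l r) (fun j => (a j : ZMod (p ^ k))) (window w T θ) J := by
  obtain ⟨hL, huL⟩ := h.leftIndex_spec hk
  obtain ⟨hM, huM⟩ := h.rightIndex_spec hk
  have hLM := leftIndex_le_rightIndex l r a p
  obtain ⟨C, hC⟩ := LCA.exists_detects (a := fun j => (a j : ZMod (p ^ k))) Finset.Subset.rfl
    (Finset.left_mem_Icc.2 hLM) (Finset.right_mem_Icc.2 hLM) huL huM hθ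
  refine ⟨C, hC.mono fun w hw => hw.mono fun T => ?_⟩
  rintro ⟨J, hcard, hJ⟩
  exact ⟨J, hcard, hJ.of_dvd
    (Finset.Icc_subset_Icc (Finset.mem_Icc.1 hL).1 (Finset.mem_Icc.1 hM).2)
    (natCast_pow_eq_zero p k) fun j => dvd_of_notMem_Icc_leftIndex_rightIndex hp k⟩

theorem exists_determines_primePow (hp : p.Prime) (k : ℕ) (l r : ℤ) (a : ℤ → ℤ) {w : ℝ}
    (hw : 0 ≤ w) :
    ∃ C : ℝ, ∀ T ≥ 0, ∃ J : Finset ℤ,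
      J.card ≤ T * sectorWidth (leftIndex l r a p) (rightIndex l r a p) θ + C ∧
      Determines (Finset.Icc l r) (fun j => (a j : ZMod (p ^ k))) (window w T θ) J :=
  exists_determines (natCast_pow_eq_zero p k)
    (fun _ => dvd_of_notMem_Icc_leftIndex_rightIndex hp k) hw

end Indices

section Metric

variable {m : ℕ}

theorem summable_div_pow_natAbs (hm : 2 ≤ m) :
    Summable fun i : ℤ => (m : ℝ) / (m : ℝ) ^ i.natAbs := by
  have hm' : (1 : ℝ) < m := by exact_mod_cast hm
  have hgeom : Summable fun n : ℕ => (m : ℝ) / (m : ℝ) ^ n := by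
    simpa only [div_eq_mul_inv, inv_pow] using (summable_geometric_of_lt_one (by positivity)
      (inv_lt_one_of_one_lt₀ hm')).mul_left (m : ℝ)
  exact .of_nat_of_neg (by simpa using hgeom) (by simpa using hgeom)

theorem configDist_term_le (hm : 2 ≤ m) (x y : ℤ → ZMod m) (i : ℤ) :
    |((x i).val : ℝ) - ((y i).val : ℝ)| / (m : ℝ) ^ i.natAbs ≤ (m : ℝ) / (m : ℝ) ^ i.natAbs := by
  have : NeZero m := ⟨by omega⟩
  have hval (b : ZMod m) : (b.val : ℝ) ≤ m := by exact_mod_cast (ZMod.val_lt b).le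
  gcongr
  exact abs_sub_le_of_nonneg_of_le (Nat.cast_nonneg _) (hval _) (Nat.cast_nonneg _) (hval _)

theorem summable_configDist (hm : 2 ≤ m) (x y : ℤ → ZMod m) :
    Summable fun i : ℤ => |((x i).val : ℝ) - ((y i).val : ℝ)| / (m : ℝ) ^ i.natAbs :=
  .of_nonneg_of_le (fun _ => by positivity) (configDist_term_le hm x y)
    (summable_div_pow_natAbs hm)

theorem one_le_configDist (hm : 2 ≤ m) {x y : ℤ → ZMod m} (h : x 0 ≠ y 0) :
    1 ≤ configDist m x y := by
  have : NeZero m := ⟨by omega⟩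
  have hval : ((x 0).val : ℤ) - (y 0).val ≠ 0 := fun heq =>
    h (ZMod.val_injective m (by omega))
  have hterm : (1 : ℝ) ≤ |((x 0).val : ℝ) - ((y 0).val : ℝ)| := by
    exact_mod_cast Int.one_le_abs hval
  refine le_trans ?_ ((summable_configDist hm x y).le_tsum 0 fun i _ => by positivity)
  simpa using hterm

theorem exists_configDist_lt (hm : 2 ≤ m) {ε : ℝ} (hε : 0 < ε) :
    ∃ K : ℕ, ∀ x y : ℤ → ZMod m, (∀ i : ℤ, i.natAbs ≤ K → x i = y i) →
      configDist m x y < ε := by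
  have htail := tendsto_tsum_compl_atTop_zero fun i : ℤ => (m : ℝ) / (m : ℝ) ^ i.natAbs
  obtain ⟨S, hS⟩ := (htail.eventually_lt_const hε).exists
  refine ⟨S.sup Int.natAbs, fun x y hxy => lt_of_le_of_lt ?_ hS⟩
  have hsum := summable_configDist hm x y
  have hzero : ∑ i ∈ S, |((x i).val : ℝ) - ((y i).val : ℝ)| / (m : ℝ) ^ i.natAbs = 0 :=
    Finset.sum_eq_zero fun i hi => by
      rw [hxy i (Finset.le_sup (f := Int.natAbs) hi), sub_self, abs_zero, zero_div]
  rw [configDist, ← hsum.sum_add_tsum_subtype_compl S, hzero, zero_add]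
  exact (hsum.subtype _).tsum_le_tsum (fun i => configDist_term_le hm x y i)
    ((summable_div_pow_natAbs hm).subtype _)

end Metric

/-! ### Separated configurations -/

section Counting

variable {m : ℕ} {l r : ℤ} {a : ℤ → ℤ}

theorem automaton_eq_correlation (m : ℕ) (l r : ℤ) (a : ℤ → ℤ) :
    automaton m l r a = correlation (Finset.Icc l r) (fun j => (a j : ZMod m)) := by
  ext x n
  rw [correlation_apply, ← Finset.sum_coe_sort]
  rfl

theorem action_apply (q : ℤ × ℕ) (x : ℤ → ZMod m) (i : ℤ) :
    action m l r a q x i =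
      (correlation (Finset.Icc l r) (fun j => (a j : ZMod m)) ^ q.2) x (i + q.1) := by
  rw [action, automaton_eq_correlation, ← Module.End.pow_apply, correlation_pow_shift, shift]

/-- The component `ZMod m →+* ZMod (p ^ k)`, with `p ^ k ∥ m`, of the Chinese remainder
isomorphism. -/
def reduction (hm : m ≠ 0) (p : m.primeFactors) :
    ZMod m →+* ZMod ((p : ℕ) ^ m.factorization p) :=
  (Pi.evalRingHom _ p).comp (ZMod.equivPi m hm).toRingHom

theorem eq_of_reduction_eq (hm : m ≠ 0) {b c : ZMod m}
    (h : ∀ p, reduction hm p b = reduction hm p c) : b = c :=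
  (ZMod.equivPi m hm).injective (funext h)

theorem exists_reduction_eq (hm : m ≠ 0)
    (u : ∀ p : m.primeFactors, ZMod ((p : ℕ) ^ m.factorization p)) :
    ∃ b, ∀ p, reduction hm p b = u p :=
  ⟨(ZMod.equivPi m hm).symm u, congrFun ((ZMod.equivPi m hm).apply_symm_apply u)⟩

theorem reduction_action_sub (hm : m ≠ 0) (p : m.primeFactors) (q : ℤ × ℕ) (x y : ℤ → ZMod m)
    (i : ℤ) :
    reduction hm p (action m l r a q x i) - reduction hm p (action m l r a q y i) =
      (correlation (Finset.Icc l r) (fun j => (a j : ZMod ((p : ℕ) ^ m.factorization p))) ^ q.2)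
        (reduction hm p ∘ x - reduction hm p ∘ y) (i + q.1) := by
  have hmap (x : ℤ → ZMod m) : reduction hm p (action m l r a q x i) =
      (correlation (Finset.Icc l r) (fun j => (a j : ZMod ((p : ℕ) ^ m.factorization p))) ^ q.2)
        (reduction hm p ∘ x) (i + q.1) := by
    have hcoeff : reduction hm p ∘ (fun j => (a j : ZMod m)) =
        fun j => (a j : ZMod ((p : ℕ) ^ m.factorization p)) := funext fun j => map_intCast _ _
    rw [action_apply, ← hcoeff, ← map_correlation_pow, Function.comp_apply]
  rw [hmap, hmap, map_sub, Pi.sub_apply]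

theorem card_pi_primeFactors (m : ℕ) (J : ℕ → Finset ℤ) :
    ENat.card (∀ p : m.primeFactors, J p → ZMod ((p : ℕ) ^ m.factorization p)) =
      ((∏ p ∈ m.primeFactors, (p ^ m.factorization p) ^ (J p).card : ℕ) : ℕ∞) := by
  have (p : m.primeFactors) : NeZero ((p : ℕ) ^ m.factorization p) :=
    ⟨pow_ne_zero _ (Nat.prime_of_mem_primeFactors p.2).ne_zero⟩
  rw [ENat.card_eq_coe_natCard, Nat.card_pi,
    ← Finset.prod_coe_sort m.primeFactors fun p => (p ^ m.factorization p) ^ (J p).card]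
  congr 1
  refine Finset.prod_congr rfl fun p _ => ?_
  rw [Nat.card_fun, Nat.card_zmod, Nat.card_eq_fintype_card, Fintype.card_coe]

theorem exists_sepNumber_le (hm : 2 ≤ m) (l r : ℤ) (a : ℤ → ℤ) (θ : ℝ) {ε : ℝ} (hε : 0 < ε) :
    ∃ K : ℕ, ∀ (w T : ℝ) (J : ℕ → Finset ℤ),
      (∀ p ∈ m.primeFactors, Determines (Finset.Icc l r)
        (fun j => (a j : ZMod (p ^ m.factorization p))) (window (w + K) T θ) (J p)) →
      sepNumber (configDist m) (action m l r a) ε (window w T θ) ≤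
        ((∏ p ∈ m.primeFactors, (p ^ m.factorization p) ^ (J p).card : ℕ) : ℕ∞) := by
  have hm0 : m ≠ 0 := by omega
  obtain ⟨K, hK⟩ := exists_configDist_lt hm hε
  refine ⟨K, fun w T J hJ => iSup₂_le fun S hS => ?_⟩
  rw [← card_pi_primeFactors, ← Set.encard_univ]
  refine Set.encard_le_encard_of_injOn (f := fun x p (i : J p) => reduction hm0 p (x i))
    (fun _ _ => Set.mem_univ _) fun x hx y hy hxy => ?_
  by_contra hne
  obtain ⟨q, hq, hd⟩ := hS x hx y hy hne
  refine hd.not_gt (hK _ _ fun i hi => eq_of_reduction_eq hm0 fun p => ?_)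
  have hiK : |(i : ℝ)| ≤ K := by
    rw [← Int.cast_abs, Int.abs_eq_natAbs]
    exact_mod_cast hi
  rw [← sub_eq_zero, reduction_action_sub]
  exact hJ p p.2 _ (fun j hj => sub_eq_zero.2 (congrFun (congrFun hxy p) ⟨j, hj⟩)) _
    (add_mem_window hq hiK)

theorem le_sepNumber (hm : 2 ≤ m) {ε : ℝ} (hε : ε ≤ 1) (W : Set (ℤ × ℕ)) (J : ℕ → Finset ℤ)
    (hJ : ∀ p ∈ m.primeFactors, Detects (Finset.Icc l r)
      (fun j => (a j : ZMod (p ^ m.factorization p))) W (J p)) :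
    ((∏ p ∈ m.primeFactors, (p ^ m.factorization p) ^ (J p).card : ℕ) : ℕ∞) ≤
      sepNumber (configDist m) (action m l r a) ε W := by
  have hm0 : m ≠ 0 := by omega
  choose E hE using fun (u : ∀ p : m.primeFactors, J p → ZMod ((p : ℕ) ^ m.factorization p))
    (n : ℤ) => exists_reduction_eq hm0 fun p => if h : n ∈ J p then u p ⟨n, h⟩ else 0
  have hinj : Function.Injective E := fun u v huv => by
    ext p ⟨n, hn⟩
    simpa [hE, hn] using congrArg (fun x => reduction hm0 p (x n)) huv
  rw [← card_pi_primeFactors]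
  refine hinj.encard_range.trans (le_iSup₂_of_le (Set.range E) ?_ le_rfl)
  rintro _ ⟨u, rfl⟩ _ ⟨v, rfl⟩ hne
  by_contra! hd
  have horbit : ∀ q ∈ W, action m l r a q (E u) 0 = action m l r a q (E v) 0 := fun q hq =>
    by_contra fun h => ((hd q hq).trans_le hε).not_ge (one_le_configDist hm h)
  refine hne (funext fun n => eq_of_reduction_eq hm0 fun p => sub_eq_zero.1 ?_)
  refine congrFun (hJ p p.2 (reduction hm0 p ∘ E u - reduction hm0 p ∘ E v) (fun i hi => ?_)
    fun q hq => ?_) n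
  · simp [hE, hi]
  · have h := reduction_action_sub (l := l) (r := r) (a := a) hm0 p q (E u) (E v) 0
    rwa [horbit q hq, sub_self, zero_add, eq_comm] at h

end Counting

/-! ### Directional entropy -/

theorem log_natCast {n : ℕ} (hn : n ≠ 0) :
    ENNReal.log (((n : ℕ∞) : ENNReal)) = ((Real.log n : ℝ) : EReal) := by
  rw [ENat.toENNReal_coe, ENNReal.log_pos_real (by exact_mod_cast hn) (ENNReal.natCast_ne_top n),
    ENNReal.toReal_natCast]

theorem log_prod_primeFactors_pow (m : ℕ) (c : ℕ → ℕ) :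
    ENNReal.log (((∏ p ∈ m.primeFactors, (p ^ m.factorization p) ^ c p : ℕ) : ℕ∞) : ENNReal) =
      ((∑ p ∈ m.primeFactors, m.factorization p * c p * Real.log p : ℝ) : EReal) := by
  have hne : ∀ p ∈ m.primeFactors, (p ^ m.factorization p) ^ c p ≠ 0 := fun p hp =>
    pow_ne_zero _ (pow_ne_zero _ (Nat.prime_of_mem_primeFactors hp).ne_zero)
  rw [log_natCast (Finset.prod_ne_zero_iff.2 hne), Nat.cast_prod,
    Real.log_prod fun p hp => Nat.cast_ne_zero.2 (hne p hp)]
  congr 1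
  refine Finset.sum_congr rfl fun p _ => ?_
  rw [Nat.cast_pow, Nat.cast_pow, Real.log_pow, Real.log_pow]
  ring

theorem coe_sum_ereal {ι : Type*} (s : Finset ι) (f : ι → ℝ) :
    ((∑ i ∈ s, f i : ℝ) : EReal) = ∑ i ∈ s, (f i : EReal) :=
  map_sum (⟨⟨Real.toEReal, EReal.coe_zero⟩, EReal.coe_add⟩ : ℝ →+ EReal) f s

theorem tendsto_mul_add_div_atTop (S D : ℝ) :
    Tendsto (fun T : ℝ => (((T * S + D : ℝ) : EReal) / (T : EReal))) atTop (𝓝 (S : EReal)) := by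
  have hreal : Tendsto (fun T : ℝ => S + D / T) atTop (𝓝 (S + 0)) :=
    tendsto_const_nhds.add (tendsto_const_nhds.div_atTop tendsto_id)
  rw [add_zero] at hreal
  refine ((continuous_coe_real_ereal.tendsto S).comp hreal).congr' ?_
  filter_upwards [eventually_ne_atTop 0] with T hT
  rw [← EReal.coe_div, Function.comp_apply]
  congr 1
  field_simp

theorem tendsto_div_of_linear_bounds {f : ℝ → EReal} {S C C' : ℝ}
    (hlow : ∀ᶠ T : ℝ in atTop, ((T * S - C : ℝ) : EReal) ≤ f T)
    (hupp : ∀ᶠ T : ℝ in atTop, f T ≤ ((T * S + C' : ℝ) : EReal)) :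
    Tendsto (fun T : ℝ => f T / (T : EReal)) atTop (𝓝 (S : EReal)) := by
  refine tendsto_of_tendsto_of_tendsto_of_le_of_le' (tendsto_mul_add_div_atTop S (-C))
    (tendsto_mul_add_div_atTop S C') ?_ ?_
  · filter_upwards [hlow, eventually_ge_atTop 0] with T h hT
    exact EReal.div_le_div_right_of_nonneg (by exact_mod_cast hT) h
  · filter_upwards [hupp, eventually_ge_atTop 0] with T h hT
    exact EReal.div_le_div_right_of_nonneg (by exact_mod_cast hT) h

theorem topDirEntropy_eq_of_eventually_tendsto {X : Type*} {d : X → X → ℝ}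
    {Φ : ℤ × ℕ → X → X} {θ : ℝ} {h : EReal}
    (hlim : ∀ᶠ ε in 𝓝[>] 0, ∀ᶠ w in atTop, Tendsto (fun T : ℝ =>
      ENNReal.log ((sepNumber d Φ ε (window w T θ) : ℕ∞) : ENNReal) / (T : EReal)) atTop (𝓝 h)) :
    topDirEntropy d Φ θ = h := by
  refine Tendsto.limsup_eq (tendsto_const_nhds.congr' (hlim.mono fun ε hε => ?_))
  exact (Tendsto.limsup_eq (tendsto_const_nhds.congr' (hε.mono fun w hw =>
    hw.limsup_eq.symm))).symm

section Entropy

variable {m : ℕ} {l r : ℤ} {a : ℤ → ℤ} {θ : ℝ}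

/-- The value `∑ g_i(θ)` of the directional entropy, with the three-piece function `g_i` written as
`k_i * sectorWidth L_i R_i θ * log p_i`. -/
def sectorEntropy (m : ℕ) (l r : ℤ) (a : ℤ → ℤ) (θ : ℝ) : ℝ :=
  ∑ p ∈ m.primeFactors,
    m.factorization p * sectorWidth (leftIndex l r a p) (rightIndex l r a p) θ * Real.log p

theorem exists_le_log_sepNumber (hm : 2 ≤ m)
    (h : ∀ p ∈ m.primeFactors, IsBipermutative (p ^ m.factorization p) l r a)
    (hθ : θ ∈ Set.Icc 0 Real.pi) :
    ∃ C : ℝ, ∀ ε ≤ 1, ∀ᶠ w in atTop, ∀ᶠ T in atTop,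
      ((T * sectorEntropy m l r a θ - C : ℝ) : EReal) ≤ ENNReal.log
        ((sepNumber (configDist m) (action m l r a) ε (window w T θ) : ℕ∞) : ENNReal) := by
  have hdet := fun p (hp : p ∈ m.primeFactors) =>
    (h p hp).exists_detects (Nat.prime_of_mem_primeFactors hp)
      (Finsupp.mem_support_iff.1 (Nat.support_factorization m ▸ hp)) hθ
  choose! C hC using hdet
  refine ⟨∑ p ∈ m.primeFactors, m.factorization p * C p * Real.log p, fun ε hε => ?_⟩
  filter_upwards [(Finset.eventually_all _).2 hC] with w hw
  filter_upwards [(Finset.eventually_all _).2 hw] with T hT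
  choose! J hcard hJ using hT
  refine le_trans ?_ (ENNReal.log_monotone
    (ENat.toENNReal_mono (le_sepNumber hm hε (window w T θ) J hJ)))
  rw [log_prod_primeFactors_pow, EReal.coe_le_coe_iff, sectorEntropy, Finset.mul_sum,
    ← Finset.sum_sub_distrib]
  refine Finset.sum_le_sum fun p hp => ?_
  calc T * (m.factorization p * sectorWidth (leftIndex l r a p) (rightIndex l r a p) θ *
        Real.log p) - m.factorization p * C p * Real.log p
      = m.factorization p * (T * sectorWidth (leftIndex l r a p) (rightIndex l r a p) θ - C p) *
          Real.log p := by ring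
    _ ≤ m.factorization p * (J p).card * Real.log p := by gcongr; exact hcard p hp

theorem exists_log_sepNumber_le (hm : 2 ≤ m) (l r : ℤ) (a : ℤ → ℤ) (θ : ℝ) {ε w : ℝ}
    (hε : 0 < ε) (hw : 0 ≤ w) :
    ∃ C : ℝ, ∀ T ≥ 0, ENNReal.log
        ((sepNumber (configDist m) (action m l r a) ε (window w T θ) : ℕ∞) : ENNReal) ≤
      ((T * sectorEntropy m l r a θ + C : ℝ) : EReal) := by
  obtain ⟨K, hK⟩ := exists_sepNumber_le hm l r a θ hε
  have hdet := fun p (hp : p ∈ m.primeFactors) =>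
    exists_determines_primePow (θ := θ) (w := w + K) (Nat.prime_of_mem_primeFactors hp)
      (m.factorization p) l r a (by positivity)
  choose! C hC using hdet
  refine ⟨∑ p ∈ m.primeFactors, m.factorization p * C p * Real.log p, fun T hT => ?_⟩
  choose! J hcard hJ using fun p hp => hC p hp T hT
  refine (ENNReal.log_monotone (ENat.toENNReal_mono (hK w T J hJ))).trans ?_
  rw [log_prod_primeFactors_pow, EReal.coe_le_coe_iff, sectorEntropy, Finset.mul_sum,
    ← Finset.sum_add_distrib]
  refine Finset.sum_le_sum fun p hp => ?_
  calc (m.factorization p * (J p).card * Real.log p : ℝ)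
      ≤ m.factorization p * (T * sectorWidth (leftIndex l r a p) (rightIndex l r a p) θ + C p) *
          Real.log p := by gcongr; exact hcard p hp
    _ = _ := by ring

theorem dirEntropy_eq_sectorEntropy (hm : 2 ≤ m)
    (h : ∀ p ∈ m.primeFactors, IsBipermutative (p ^ m.factorization p) l r a)
    (hθ : θ ∈ Set.Icc 0 Real.pi) :
    dirEntropy m l r a θ = (sectorEntropy m l r a θ : EReal) := by
  refine topDirEntropy_eq_of_eventually_tendsto ?_
  obtain ⟨C, hC⟩ := exists_le_log_sepNumber hm h hθ
  filter_upwards [Ioc_mem_nhdsGT one_pos] with ε hε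
  filter_upwards [hC ε hε.2, eventually_ge_atTop 0] with w hlow hw
  obtain ⟨C', hC'⟩ := exists_log_sepNumber_le hm l r a θ hε.1 hw
  exact tendsto_div_of_linear_bounds hlow ((eventually_ge_atTop 0).mono hC')

theorem dirEntropy_primePow {p k : ℕ} (hp : p.Prime) (hk : k ≠ 0)
    (h : IsBipermutative (p ^ k) l r a) (hθ : θ ∈ Set.Icc 0 Real.pi) :
    dirEntropy (p ^ k) l r a θ =
      ((k * sectorWidth (leftIndex l r a p) (rightIndex l r a p) θ * Real.log p : ℝ) : EReal) := by
  have hfac : (p ^ k).factorization p = k := Nat.factorization_pow_self hp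
  rw [dirEntropy_eq_sectorEntropy (hp.two_le.trans (Nat.le_self_pow hk p)) ?_ hθ, sectorEntropy,
    Nat.primeFactors_prime_pow hk hp, Finset.sum_singleton, hfac]
  simpa only [Nat.primeFactors_prime_pow hk hp, Finset.mem_singleton, forall_eq, hfac] using h

theorem dirEntropy_eq_sum_dirEntropy (hm : 2 ≤ m)
    (h : ∀ p ∈ m.primeFactors, IsBipermutative (p ^ m.factorization p) l r a)
    (hθ : θ ∈ Set.Icc 0 Real.pi) :
    dirEntropy m l r a θ =
      ∑ p ∈ m.primeFactors, dirEntropy (p ^ m.factorization p) l r a θ := by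
  rw [dirEntropy_eq_sectorEntropy hm h hθ, sectorEntropy, coe_sum_ereal]
  exact Finset.sum_congr rfl fun p hp => (dirEntropy_primePow (Nat.prime_of_mem_primeFactors hp)
    (Finsupp.mem_support_iff.1 (Nat.support_factorization m ▸ hp)) (h p hp) hθ).symm

theorem sectorEntropy_eq_sum_sectorTerm (m : ℕ) (l r : ℤ) (a : ℤ → ℤ)
    (hθ : θ ∈ Set.Icc 0 Real.pi) :
    sectorEntropy m l r a θ = ∑ p ∈ m.primeFactors,
      sectorTerm p (m.factorization p) (leftIndex l r a p) (rightIndex l r a p) θ :=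
  Finset.sum_congr rfl fun p _ => (sectorTerm_eq (leftIndex_le_rightIndex l r a p) hθ p _).symm

end Entropy

end LCA

end

theorem theorem4p4 (m : ℕ) (hm : 2 ≤ m) (l r : ℤ) (a : ℤ → ℤ)
    (hleft : ∀ p ∈ m.primeFactors, ∃ j : Finset.Icc l r, (j : ℤ) ≤ 0 ∧
      LCA.PermutativeIn (LCA.localRule (p ^ m.factorization p) l r a) j)
    (hright : ∀ p ∈ m.primeFactors, ∃ j : Finset.Icc l r, 0 ≤ (j : ℤ) ∧
      LCA.PermutativeIn (LCA.localRule (p ^ m.factorization p) l r a) j)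
    (θ : ℝ) (hθ : θ ∈ Set.Icc 0 Real.pi) :
    -- the entropy is the sum of the entropies of the reductions
    LCA.dirEntropy m l r a θ =
        ∑ p ∈ m.primeFactors, LCA.dirEntropy (p ^ m.factorization p) l r a θ ∧
    -- explicit value, as a sum of three-piece functions
    LCA.dirEntropy m l r a θ =
        ((∑ p ∈ m.primeFactors, LCA.sectorTerm p (m.factorization p)
          (LCA.leftIndex l r a p) (LCA.rightIndex l r a p) θ : ℝ) : EReal) ∧
    -- the same value written out on each closed sector cut out by the angles `θ_L` and `θ_R`
    ∀ A B C : Finset ℕ, Disjoint A B → Disjoint (A ∪ B) C → A ∪ B ∪ C = m.primeFactors →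
      (∀ p ∈ A, θ ≤ LCA.arccot (-(LCA.leftIndex l r a p : ℝ))) →
      (∀ p ∈ B, LCA.arccot (-(LCA.leftIndex l r a p : ℝ)) ≤ θ ∧
        θ ≤ LCA.arccot (-(LCA.rightIndex l r a p : ℝ))) →
      (∀ p ∈ C, LCA.arccot (-(LCA.rightIndex l r a p : ℝ)) ≤ θ) →
      LCA.dirEntropy m l r a θ =
        ((∑ p ∈ A, (m.factorization p : ℝ) *
              |Real.cos θ + (LCA.rightIndex l r a p : ℝ) * Real.sin θ| * Real.log (p : ℝ) +
          ∑ p ∈ B, (m.factorization p : ℝ) *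
              |((LCA.rightIndex l r a p : ℝ) - (LCA.leftIndex l r a p : ℝ)) * Real.sin θ| *
                Real.log (p : ℝ) +
          ∑ p ∈ C, (m.factorization p : ℝ) *
              |Real.cos θ + (LCA.leftIndex l r a p : ℝ) * Real.sin θ| * Real.log (p : ℝ) : ℝ) :
          EReal) := by
  have hperm : ∀ p ∈ m.primeFactors, LCA.IsBipermutative (p ^ m.factorization p) l r a :=
    fun p hp => ⟨hleft p hp, hright p hp⟩
  have hvalue := LCA.dirEntropy_eq_sectorEntropy hm hperm hθ
  have hLM := LCA.leftIndex_le_rightIndex l r a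
  refine ⟨LCA.dirEntropy_eq_sum_dirEntropy hm hperm hθ,
    by rw [hvalue, LCA.sectorEntropy_eq_sum_sectorTerm m l r a hθ],
    fun A B C hAB hABC hunion hA hB hC => ?_⟩
  rw [hvalue, LCA.sectorEntropy, ← hunion, Finset.sum_union hABC, Finset.sum_union hAB]
  refine congrArg _ (congrArg₂ _ (congrArg₂ _ ?_ ?_) ?_) <;>
    refine Finset.sum_congr rfl fun p hp => ?_
  · rw [LCA.sectorWidth_of_le_left (hLM p) hθ (hA p hp)]
  · rw [LCA.sectorWidth_of_mid hθ (hB p hp).1 (hB p hp).2]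
  · rw [LCA.sectorWidth_of_right_le (hLM p) hθ (hC p hp)]
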